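/- Write $M_n=M_n(\mathbb C)$ and $\mathbb N=\{0,1,2,\dots\}$. A double-pointed space $\mathbb X=(X,x_0,x_1)$ is a compact Hausdorff space $X$ with two distinct points $x_0,x_1\in X$. For $k\in\mathbb N$ let $$R(\mathbb X,k)=\{f\in C(X,M_{k+1}) : \exists\,\lambda\in\mathbb C,\ f(x_0)=\operatorname{diag}(\underbrace{\lambda,\dots,\lambda}_{k},0),\ f(x_1)=\lambda 1_{k+1}\}.$$ For continuous maps $\alpha_1,\dots,\alpha_p:Y\to X$ and $n,r,N\in\mathbb N$ with $pn+r=N$, let $D_{\alpha_1,\dots,\alpha_p;r}:C(X,M_n)\to C(Y,M_N)$ be $$D_{\alpha_1,\dots,\alpha_p;r}(f)=\operatorname{diag}(f\circ\alpha_1,\dots,f\circ\alpha_p,0_r).$$ **Proposition.** Let $\mathbb X=(X,x_0,x_1)$ and $\mathbb Y=(Y,y_0,y_1)$ be double-pointed spaces and let $k,\ell,m,p,r\in\mathbb N$ satisfy $p(k+1)+r=m(\ell+1)$. Let $\alpha_1,\dots,\alpha_p:Y\to X$ be continuous. Identify $C(Y,M_{m(\ell+1)})$ with $C(Y,M_{\ell+1})\otimes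 M_m$. The following are equivalent: 1. There is a unitary $u\in C(Y,M_{\ell+1})\otimes M_m$ such that $u\,D_{\alpha_1,\dots,\alpha_p;r}(R(\mathbb X,k))\,u^*\subseteq R(\mathbb Y,\ell)\otimes M_m$. 2. There are $s\in\mathbb N$, points $z_1,\dots,z_s\in X$ (not necessarily distinct) and $a_0,a_1,b_0,b_1,q\in\mathbb N$ such that, counting multiplicity, $$\{\alpha_1(y_0),\dots,\alpha_p(y_0)\}=a_0\{x_0\}\cup a_1\{x_1\}\cup \ell\{z_1\}\cup\dots\cup \ell\{z_s\},$$ $$\{\alpha_1(y_1),\dots,\alpha_p(y_1)\}=b_0\{x_0\}\cup b_1\{x_1\}\cup(\ell+1)\{z_1\}\cup\dots\cup(\ell+1)\{z_s\},$$ and, as equations in $\mathbb Z$, $$ka_0+(k+1)a_1=(m-s(k+1)-q)\,\ell,\qquad kb_0+(k+1)b_1=(m-s(k+1)-q)(\ell+1).$$ -/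

import Mathlib

open scoped Kronecker

/-- `M_n`, the algebra of complex `n × n` matrices. -/
abbrev CMat (n : ℕ) : Type := Matrix (Fin n) (Fin n) ℂ

/-- The generalized Razak building block `R((X, x₀, x₁), k)`: the continuous functions
`f : X → M_{k+1}` for which there is a scalar `c` with
`f x₀ = diag (c, …, c, 0)` (`k` copies of `c`) and `f x₁ = diag (c, …, c)` (`k + 1` copies). -/
def razakBlock {X : Type*} [TopologicalSpace X] (x₀ x₁ : X) (k : ℕ) :
    NonUnitalStarSubalgebra ℂ C(X, CMat (k + 1)) where
  carrier := {f | ∃ c : ℂ,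
    f x₀ = Matrix.diagonal (fun i => if i = Fin.last k then 0 else c) ∧
    f x₁ = Matrix.diagonal (fun _ => c)}
  zero_mem' := ⟨0, by ext i j; simp, by ext i j; simp⟩
  add_mem' := by
    rintro f g ⟨c, hc₀, hc₁⟩ ⟨d, hd₀, hd₁⟩
    refine ⟨c + d, ?_, ?_⟩
    · rw [ContinuousMap.add_apply, hc₀, hd₀, Matrix.diagonal_add]
      congr 1; funext i; split_ifs <;> simp
    · rw [ContinuousMap.add_apply, hc₁, hd₁, Matrix.diagonal_add]
  mul_mem' := by
    rintro f g ⟨c, hc₀, hc₁⟩ ⟨d, hd₀, hd₁⟩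
    refine ⟨c * d, ?_, ?_⟩
    · rw [ContinuousMap.mul_apply, hc₀, hd₀, Matrix.diagonal_mul_diagonal]
      congr 1; funext i; split_ifs <;> simp
    · rw [ContinuousMap.mul_apply, hc₁, hd₁, Matrix.diagonal_mul_diagonal]
  smul_mem' := by
    rintro a f ⟨c, hc₀, hc₁⟩
    refine ⟨a * c, ?_, ?_⟩
    · rw [ContinuousMap.smul_apply, hc₀, ← Matrix.diagonal_smul]
      congr 1; funext i; simp
    · rw [ContinuousMap.smul_apply, hc₁, ← Matrix.diagonal_smul]
      congr 1
  star_mem' := by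
    rintro f ⟨c, hc₀, hc₁⟩
    refine ⟨star c, ?_, ?_⟩
    · rw [ContinuousMap.star_apply, hc₀, Matrix.star_eq_conjTranspose,
        Matrix.diagonal_conjTranspose]
      congr 1; funext i; simp only [Pi.star_apply]; split_ifs <;> simp
    · rw [ContinuousMap.star_apply, hc₁, Matrix.star_eq_conjTranspose,
        Matrix.diagonal_conjTranspose]
      congr 1

/-- The elementary tensor `a ⊗ b ∈ M_n ⊗ M_m = M_{nm}` (the Kronecker product). -/
noncomputable def kronFin {n m : ℕ} (a : CMat n) (b : CMat m) : CMat (n * m) :=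
  Matrix.reindex finProdFinEquiv finProdFinEquiv (a ⊗ₖ b)

/-- For a subalgebra `A` of `C(Y, M_n)`, the tensor product `A ⊗ M_m`, realized inside
`C(Y, M_n) ⊗ M_m = C(Y, M_{nm})` as the linear span of the elementary tensors
`f ⊗ b = (y ↦ f y ⊗ b)` with `f ∈ A` and `b ∈ M_m`. -/
noncomputable def tensorMat {Y : Type*} [TopologicalSpace Y] {n : ℕ}
    (A : NonUnitalStarSubalgebra ℂ C(Y, CMat n)) (m : ℕ) :
    Submodule ℂ C(Y, CMat (n * m)) :=
  Submodule.span ℂ {g | ∃ f ∈ A, ∃ b : CMat m, ∀ y, g y = kronFin (f y) b}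

/-- The diagonal map `D_{α₁,…,α_p;r} : C(X, M_n) → C(Y, M_N)`, where `p n + r = N`:
`f ↦ diag (f ∘ α₁, …, f ∘ α_p, 0_r)`. -/
noncomputable def diagMap {X Y : Type*} [TopologicalSpace X] [TopologicalSpace Y] {n p r N : ℕ}
    (h : p * n + r = N) (α : Fin p → C(Y, X)) (f : C(X, CMat n)) : C(Y, CMat N) where
  toFun y :=
    Matrix.reindex
      ((Equiv.sumCongr ((Equiv.prodComm (Fin n) (Fin p)).trans finProdFinEquiv)
        (Equiv.refl (Fin r))).trans (finSumFinEquiv.trans (finCongr h)))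
      ((Equiv.sumCongr ((Equiv.prodComm (Fin n) (Fin p)).trans finProdFinEquiv)
        (Equiv.refl (Fin r))).trans (finSumFinEquiv.trans (finCongr h)))
      (Matrix.fromBlocks (Matrix.blockDiagonal fun i => f (α i y)) 0 0 (0 : CMat r))
  continuous_toFun := by
    refine Continuous.matrix_reindex (Continuous.matrix_fromBlocks ?_ continuous_const
      continuous_const continuous_const) _ _
    exact Continuous.matrix_blockDiagonal (by fun_prop)

/-! ### Traces -/

/-! Necessity is a trace count. Conjugation by `u` preserves pointwise traces, and the traces of an
element of R(Y, l) ⊗ M_m at y₀ and y₁ are in the ratio l : l + 1 (`trace_of_mem_tensorMat`). So each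
f in R(X, k) gives a linear relation between the multisets {α_i(y₀)} and {α_i(y₁)}
(`trace_sum_relation`). Bumps at points z other than x₀, x₁ show that the multiplicities of z are
l·n and (l + 1)·n for some n. An f with scalar 1, of trace zero at the other points, gives the same
shape l·t, (l + 1)·t for the weighted multiplicities of x₀ and x₁. Then q = m - s(k + 1) - t, which
is nonnegative by a count of dimensions.

For sufficiency, let c be the scalar of f and B = diag(f z₁, …, f z_s, c 1_t, 0_q) in M_m. Up to
permutations of the basis independent of f, D(f) is diag(1_l, 0) ⊗ B at y₀ and 1_{l+1} ⊗ B at y₁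
(`exists_perm_kronFin_eq_submatrix`). Only these two values matter for membership
(`mem_tensorMat_of_eq_kronFin`), and a single unitary over Y takes both permutation matrices as
values (`exists_unitary_interpolating`). -/

theorem Matrix.trace_reindex_self {ι κ R : Type*} [Fintype ι] [Fintype κ] [AddCommMonoid R]
    (e : ι ≃ κ) (A : Matrix ι ι R) : (Matrix.reindex e e A).trace = A.trace := by
  simp only [Matrix.trace, Matrix.diag_apply, Matrix.reindex_apply, Matrix.submatrix_apply]
  exact e.symm.sum_comp fun i => A i i

theorem trace_kronFin {n m : ℕ} (a : CMat n) (b : CMat m) :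
    (kronFin a b).trace = a.trace * b.trace := by
  rw [kronFin, Matrix.trace_reindex_self, Matrix.trace_kronecker]

theorem trace_diagMap {X Y : Type*} [TopologicalSpace X] [TopologicalSpace Y] {n p r N : ℕ}
    (h : p * n + r = N) (α : Fin p → C(Y, X)) (f : C(X, CMat n)) (y : Y) :
    (diagMap h α f y).trace = ∑ i, (f (α i y)).trace := by
  change (Matrix.reindex _ _ _).trace = _
  rw [Matrix.trace_reindex_self, ← Matrix.trace_blockDiagonal]
  simp [Matrix.trace, Fintype.sum_sum_type]

theorem trace_of_mem_tensorMat {Y : Type*} [TopologicalSpace Y] {y₀ y₁ : Y} {l m : ℕ}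
    {g : C(Y, CMat ((l + 1) * m))} (hg : g ∈ tensorMat (razakBlock y₀ y₁ l) m) :
    ∃ c : ℂ, (g y₀).trace = l * c ∧ (g y₁).trace = (l + 1) * c := by
  refine Submodule.span_induction ?_ ?_ ?_ ?_ hg
  · rintro g ⟨f, ⟨c, hc₀, hc₁⟩, b, hb⟩
    refine ⟨c * b.trace, ?_, ?_⟩
    · rw [hb, trace_kronFin, hc₀, Matrix.trace_diagonal, Fin.sum_univ_castSucc]
      simp [Fin.castSucc_ne_last]
      ring
    · rw [hb, trace_kronFin, hc₁, Matrix.trace_diagonal]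
      simp
      ring
  · exact ⟨0, by simp⟩
  · rintro f g - - ⟨c, hc₀, hc₁⟩ ⟨d, hd₀, hd₁⟩
    exact ⟨c + d, by simp [hc₀, hd₀, mul_add], by simp [hc₁, hd₁, mul_add]⟩
  · rintro a g - ⟨c, hc₀, hc₁⟩
    exact ⟨a * c, by simp [hc₀]; ring, by simp [hc₁]; ring⟩

theorem trace_unitary_conj_apply {Y : Type*} [TopologicalSpace Y] {N : ℕ}
    {u : C(Y, CMat N)} (hu : u ∈ unitary C(Y, CMat N)) (g : C(Y, CMat N)) (y : Y) :
    ((u * g * star u) y).trace = (g y).trace := by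
  have h : star (u y) * u y = 1 := by
    simpa using DFunLike.congr_fun (Unitary.star_mul_self_of_mem hu) y
  rw [ContinuousMap.mul_apply, ContinuousMap.mul_apply, ContinuousMap.star_apply,
    Matrix.trace_mul_cycle, h, one_mul]

/-- The defining consequence of the intertwining relation at the level of traces. -/
theorem trace_sum_relation {X Y : Type*} [TopologicalSpace X] [TopologicalSpace Y]
    {x₀ x₁ : X} {y₀ y₁ : Y} {k l m p r : ℕ} (h : p * (k + 1) + r = (l + 1) * m)
    {α : Fin p → C(Y, X)} {u : C(Y, CMat ((l + 1) * m))}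
    (hu : u ∈ unitary C(Y, CMat ((l + 1) * m)))
    (H : ∀ f ∈ razakBlock x₀ x₁ k,
      u * diagMap h α f * star u ∈ tensorMat (razakBlock y₀ y₁ l) m)
    {f : C(X, CMat (k + 1))} (hf : f ∈ razakBlock x₀ x₁ k) :
    (l + 1) * ∑ i, (f (α i y₀)).trace = l * ∑ i, (f (α i y₁)).trace := by
  obtain ⟨c, h₀, h₁⟩ := trace_of_mem_tensorMat (H f hf)
  rw [trace_unitary_conj_apply hu, trace_diagMap] at h₀ h₁
  rw [h₀, h₁]
  ring

/-! ### Bump functions -/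

theorem exists_bump_of_finite {X : Type*} [TopologicalSpace X] [NormalSpace X] [T1Space X]
    {F : Set X} (hF : F.Finite) (z : X) :
    ∃ φ : C(X, ℂ), φ z = 1 ∧ ∀ x ∈ F, x ≠ z → φ x = 0 := by
  obtain ⟨φ, h₀, h₁, -⟩ := exists_continuous_zero_one_of_isClosed
    (hF.subset (Set.sdiff_subset (t := {z}))).isClosed (isClosed_singleton (x := z))
    Set.disjoint_sdiff_left
  refine ⟨⟨fun x => (φ x : ℂ), by fun_prop⟩, ?_, fun x hx hxz => ?_⟩
  · simpa using h₁ rfl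
  · simpa using h₀ ⟨hx, hxz⟩

theorem trace_diagonal_razak (k : ℕ) (c : ℂ) :
    (Matrix.diagonal fun i : Fin (k + 1) => if i = Fin.last k then 0 else c).trace = k * c := by
  rw [Matrix.trace_diagonal, Fin.sum_univ_castSucc]
  simp [Fin.castSucc_ne_last]

theorem exists_razakBlock_bump {X : Type*} [TopologicalSpace X] [NormalSpace X] [T1Space X]
    {x₀ x₁ : X} {F : Set X} (hF : F.Finite) {z : X} (hz₀ : z ≠ x₀) (hz₁ : z ≠ x₁) (k : ℕ) :
    ∃ f ∈ razakBlock x₀ x₁ k, (f z).trace = 1 ∧ ∀ x ∈ F, x ≠ z → (f x).trace = 0 := by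
  obtain ⟨φ, hφz, hφ⟩ := exists_bump_of_finite ((hF.insert x₁).insert x₀) z
  -- The bump vanishes at x₀ and x₁, so the boundary condition holds with scalar 0; rank one makes
  -- the trace count each occurrence of z once.
  refine ⟨⟨fun x => φ x • Matrix.single 0 0 1, by fun_prop⟩, ⟨0, ?_, ?_⟩, ?_, ?_⟩
  · simp [hφ x₀ (by simp) hz₀.symm]
  · simp [hφ x₁ (by simp) hz₁.symm]
  · simp [hφz]
  · intro x hx hxz
    simp [hφ x (by simp [hx]) hxz]

theorem exists_razakBlock_base {X : Type*} [TopologicalSpace X] [NormalSpace X] [T1Space X]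
    {x₀ x₁ : X} (hx : x₀ ≠ x₁) {F : Set X} (hF : F.Finite) (k : ℕ) :
    ∃ f ∈ razakBlock x₀ x₁ k, (f x₀).trace = k ∧ (f x₁).trace = k + 1 ∧
      ∀ x ∈ F, x ≠ x₀ → x ≠ x₁ → (f x).trace = 0 := by
  obtain ⟨φ, hφ₀, hφ⟩ := exists_bump_of_finite ((hF.insert x₁).insert x₀) x₀
  obtain ⟨ψ, hψ₁, hψ⟩ := exists_bump_of_finite ((hF.insert x₁).insert x₀) x₁
  let E : CMat (k + 1) := Matrix.diagonal fun i => if i = Fin.last k then 0 else 1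
  let f : C(X, CMat (k + 1)) := ⟨fun x => φ x • E + ψ x • (1 : CMat (k + 1)), by fun_prop⟩
  have e₀ : f x₀ = E := by simp [f, hφ₀, hψ x₀ (by simp) hx]
  have e₁ : f x₁ = 1 := by simp [f, hψ₁, hφ x₁ (by simp) hx.symm]
  refine ⟨f, ⟨1, e₀, by rw [e₁, Matrix.diagonal_one]⟩, ?_, ?_, ?_⟩
  · rw [e₀, trace_diagonal_razak, mul_one]
  · rw [e₁]; simp
  · intro x hxF h₀ h₁
    simp [f, hφ x (by simp [hxF]) h₀, hψ x (by simp [hxF]) h₁]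

/-! ### Multiplicities -/

theorem count_map_univ_cast {X : Type*} [DecidableEq X] {p : ℕ} (f : Fin p → X) (x : X) :
    (((Finset.univ.val.map f).count x : ℕ) : ℂ) = ∑ i, if f i = x then 1 else 0 := by
  rw [Multiset.count_map, Finset.sum_boole]
  simp only [eq_comm (a := x)]
  rfl

theorem sum_replicate_eq_nsmul {X : Type*} {s : ℕ} (z : Fin s → X) (d : ℕ) :
    ∑ j, Multiset.replicate d (z j) = d • (Finset.univ.val.map z) := by
  have : (Finset.univ.val.map z) = ∑ j, ({z j} : Multiset X) := by
    rw [← Multiset.sum_map_singleton (Finset.univ.val.map z), Multiset.map_map]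
    rfl
  rw [this, Finset.smul_sum]
  simp [Multiset.nsmul_singleton]

/-- As l and l + 1 are coprime, a and b are these multiples of a common quotient, which must be b -
a. -/
theorem eq_mul_of_succ_mul_eq {l a b : ℕ} (h : (l + 1) * a = l * b) :
    a = l * (b - a) ∧ b = (l + 1) * (b - a) := by
  have hab : a ≤ b := by
    by_contra! hlt
    nlinarith
  obtain ⟨c, rfl⟩ := Nat.exists_eq_add_of_le hab
  rw [Nat.add_sub_cancel_left]
  constructor <;> nlinarith

theorem exists_multiplicities_of_unitary {X Y : Type*}
    [TopologicalSpace X] [CompactSpace X] [T2Space X] [TopologicalSpace Y]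
    {x₀ x₁ : X} (hx : x₀ ≠ x₁) {y₀ y₁ : Y}
    {k l m p r : ℕ} (h : p * (k + 1) + r = (l + 1) * m)
    {α : Fin p → C(Y, X)} {u : C(Y, CMat ((l + 1) * m))}
    (hu : u ∈ unitary C(Y, CMat ((l + 1) * m)))
    (H : ∀ f ∈ razakBlock x₀ x₁ k,
      u * diagMap h α f * star u ∈ tensorMat (razakBlock y₀ y₁ l) m) :
    ∃ (s : ℕ) (z : Fin s → X) (a₀ a₁ b₀ b₁ q : ℕ),
      (Finset.univ.val.map fun i => α i y₀) =
        Multiset.replicate a₀ x₀ + Multiset.replicate a₁ x₁ +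
          ∑ j, Multiset.replicate l (z j) ∧
      (Finset.univ.val.map fun i => α i y₁) =
        Multiset.replicate b₀ x₀ + Multiset.replicate b₁ x₁ +
          ∑ j, Multiset.replicate (l + 1) (z j) ∧
      (k * a₀ + (k + 1) * a₁ : ℤ) = (m - s * (k + 1) - q) * l ∧
      (k * b₀ + (k + 1) * b₁ : ℤ) = (m - s * (k + 1) - q) * (l + 1) := by
  classical
  set M : Y → Multiset X := fun y => Finset.univ.val.map fun i => α i y with hM
  let F : Set X := Set.range (fun i => α i y₀) ∪ Set.range (fun i => α i y₁)
  have hF : F.Finite := (Set.finite_range _).union (Set.finite_range _)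
  have hF₀ (i) : α i y₀ ∈ F := Or.inl ⟨i, rfl⟩
  have hF₁ (i) : α i y₁ ∈ F := Or.inr ⟨i, rfl⟩
  have hcount {z : X} (hz₀ : z ≠ x₀) (hz₁ : z ≠ x₁) :
      (l + 1) * (M y₀).count z = l * (M y₁).count z := by
    obtain ⟨f, hf, hfz, hfF⟩ := exists_razakBlock_bump hF hz₀ hz₁ k
    have key {x} (hx : x ∈ F) : (f x).trace = if x = z then 1 else 0 := by
      split_ifs with hxz
      · rw [hxz, hfz]
      · exact hfF x hx hxz
    have := trace_sum_relation h hu H hf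
    simp only [key (hF₀ _), key (hF₁ _)] at this
    rw [← count_map_univ_cast (fun i => α i y₀), ← count_map_univ_cast (fun i => α i y₁)] at this
    exact_mod_cast this
  have hbase : (l + 1) * (k * (M y₀).count x₀ + (k + 1) * (M y₀).count x₁) =
      l * (k * (M y₁).count x₀ + (k + 1) * (M y₁).count x₁) := by
    obtain ⟨f, hf, hf₀, hf₁, hfF⟩ := exists_razakBlock_base hx hF k
    have key {x} (hxF : x ∈ F) : (f x).trace =
        k * (if x = x₀ then 1 else 0) + (k + 1) * (if x = x₁ then 1 else 0) := by
      by_cases h₀ : x = x₀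
      · simp [h₀, hf₀, hx]
      by_cases h₁ : x = x₁
      · simp [h₁, hf₁, hx.symm]
      simp [hfF x hxF h₀ h₁, h₀, h₁]
    have := trace_sum_relation h hu H hf
    simp only [key (hF₀ _), key (hF₁ _), Finset.sum_add_distrib, ← Finset.mul_sum] at this
    simp only [← count_map_univ_cast (fun i => α i y₀),
      ← count_map_univ_cast (fun i => α i y₁)] at this
    exact_mod_cast this
  let P : X → Prop := fun x => x ≠ x₀ ∧ x ≠ x₁
  -- The multiset of the z_j: off x₀ and x₁ the multiplicities are l·n and (l + 1)·n, so their
  -- difference is n.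
  let Z : Multiset X := (M y₁).filter P - (M y₀).filter P
  have hZ (x) : Z.count x = if P x then (M y₁).count x - (M y₀).count x else 0 := by
    rw [Multiset.count_sub, Multiset.count_filter, Multiset.count_filter]
    split_ifs <;> rfl
  have hdecomp (y : Y) (d : ℕ) (hd : ∀ x, P x → (M y).count x = d * Z.count x) :
      M y = Multiset.replicate ((M y).count x₀) x₀ + Multiset.replicate ((M y).count x₁) x₁ +
        d • Z := by
    ext x
    rw [Multiset.count_add, Multiset.count_add, Multiset.count_nsmul, Multiset.count_replicate,
      Multiset.count_replicate]
    by_cases h₀ : x = x₀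
    · simp [hZ, P, h₀, hx.symm]
    by_cases h₁ : x = x₁
    · simp [hZ, P, h₁, hx]
    rw [hd x ⟨h₀, h₁⟩, if_neg (Ne.symm h₀), if_neg (Ne.symm h₁)]
    omega
  have hM₀ := hdecomp y₀ l fun x hPx => by
    rw [hZ, if_pos hPx]
    exact (eq_mul_of_succ_mul_eq (hcount hPx.1 hPx.2)).1
  have hM₁ := hdecomp y₁ (l + 1) fun x hPx => by
    rw [hZ, if_pos hPx]
    exact (eq_mul_of_succ_mul_eq (hcount hPx.1 hPx.2)).2
  have hcard := congrArg Multiset.card hM₁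
  have hcardM : (M y₁).card = p := by simp [hM]
  rw [hcardM] at hcard
  simp only [Multiset.card_add, Multiset.card_replicate, Multiset.card_nsmul] at hcard
  obtain ⟨ht₀, ht₁⟩ := eq_mul_of_succ_mul_eq hbase
  clear_value Z
  generalize (M y₀).count x₀ = a₀ at *
  generalize (M y₀).count x₁ = a₁ at *
  generalize (M y₁).count x₀ = b₀ at *
  generalize (M y₁).count x₁ = b₁ at *
  generalize k * b₀ + (k + 1) * b₁ - (k * a₀ + (k + 1) * a₁) = t at ht₀ ht₁
  -- Dimension count at y₁, where the factor l + 1 can be cancelled (l may be 0): p = b₀ + b₁ + (l +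
  -- 1)|Z| and (l + 1)t ≤ (k + 1)(b₀ + b₁).
  have hle : Z.card * (k + 1) + t ≤ m := by
    refine Nat.le_of_mul_le_mul_left (c := l + 1) ?_ (by omega)
    rw [← h, hcard]
    nlinarith
  have hq : ((m : ℤ) - Z.card * (k + 1) - (m - (Z.card * (k + 1) + t) : ℕ)) = t := by
    push_cast [Nat.cast_sub hle]
    ring
  have hlist : Finset.univ.val.map (fun j : Fin Z.card => Z.toList.get (j.cast (by simp))) = Z := by
    conv_rhs => rw [← Multiset.coe_toList Z]
    rw [Fin.univ_val_map, Multiset.coe_eq_coe]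
    refine List.Perm.of_eq (List.ext_get (by simp) fun i _ _ => by simp)
  refine ⟨Z.card, fun j => Z.toList.get (j.cast (by simp)), a₀, a₁, b₀, b₁,
    m - (Z.card * (k + 1) + t), ?_, ?_, ?_, ?_⟩
  · rw [sum_replicate_eq_nsmul, hlist]
    exact hM₀
  · rw [sum_replicate_eq_nsmul, hlist]
    exact hM₁
  · rw [hq, mul_comm (t : ℤ)]
    exact_mod_cast ht₀
  · rw [hq, mul_comm (t : ℤ)]
    exact_mod_cast ht₁

/-! ### Membership in the tensor product -/

theorem kronFin_apply {n m : ℕ} (a : CMat n) (b : CMat m) (i i' : Fin n) (j j' : Fin m) :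
    kronFin a b (finProdFinEquiv (i, j)) (finProdFinEquiv (i', j')) = a i i' * b j j' := by
  simp [kronFin, Matrix.kroneckerMap_apply]

/-- Expand g as the sum of G i j ⊗ e_{ij}; each coefficient G i j satisfies the boundary condition
with scalar B i j. -/
theorem mem_tensorMat_of_eq_kronFin {Y : Type*} [TopologicalSpace Y] {y₀ y₁ : Y} {l m : ℕ}
    {g : C(Y, CMat ((l + 1) * m))} {B : CMat m}
    (h₀ : g y₀ = kronFin (Matrix.diagonal fun i => if i = Fin.last l then 0 else 1) B)
    (h₁ : g y₁ = kronFin 1 B) : g ∈ tensorMat (razakBlock y₀ y₁ l) m := by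
  let G (i j : Fin m) : C(Y, CMat (l + 1)) :=
    ⟨fun y => Matrix.of fun a b => g y (finProdFinEquiv (a, i)) (finProdFinEquiv (b, j)), by
      refine continuous_matrix fun a b => ?_
      exact g.continuous.matrix_elem _ _⟩
  let K (i j : Fin m) : C(Y, CMat ((l + 1) * m)) :=
    ⟨fun y => kronFin (G i j y) (Matrix.single i j 1), by
      refine Continuous.matrix_reindex ?_ _ _
      refine continuous_matrix fun a b => ?_
      simp only [Matrix.kroneckerMap_apply]
      exact ((G i j).continuous.matrix_elem _ _).mul continuous_const⟩
  have hg : g = ∑ i, ∑ j, K i j := by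
    ext y u v
    obtain ⟨⟨a, i⟩, rfl⟩ := finProdFinEquiv.surjective u
    obtain ⟨⟨b, j⟩, rfl⟩ := finProdFinEquiv.surjective v
    have hK (i' j' : Fin m) : K i' j' y (finProdFinEquiv (a, i)) (finProdFinEquiv (b, j)) =
        G i' j' y a b * Matrix.single i' j' 1 i j := kronFin_apply _ _ _ _ _ _
    simp only [ContinuousMap.coe_sum, Finset.sum_apply, Matrix.sum_apply, hK, Matrix.single_apply]
    rw [Finset.sum_eq_single i (fun i' _ hi' => by simp [hi']) (by simp),
      Finset.sum_eq_single j (fun j' _ hj' => by simp [hj']) (by simp)]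
    simp [G]
  rw [hg]
  refine Submodule.sum_mem _ fun i _ => Submodule.sum_mem _ fun j _ =>
    Submodule.subset_span ⟨G i j, ⟨B i j, ?_, ?_⟩, Matrix.single i j 1, fun y => rfl⟩
  · ext a b
    simp only [G, ContinuousMap.coe_mk, Matrix.of_apply, h₀, kronFin_apply, Matrix.diagonal_apply]
    split_ifs <;> simp
  · ext a b
    simp only [G, ContinuousMap.coe_mk, Matrix.of_apply, h₁, kronFin_apply, Matrix.diagonal_apply,
      Matrix.one_apply]
    split_ifs <;> simp

/-! ### Paths of unitaries ending at permutation matrices -/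

theorem exists_unitary_path_swap {N : ℕ} (i j : Fin N) :
    ∃ γ : C(ℝ, CMat N), (∀ t, γ t ∈ unitary (CMat N)) ∧ γ 0 = 1 ∧
      γ 1 = (Equiv.swap i j).permMatrix ℂ := by
  set T : CMat N := (Equiv.swap i j).permMatrix ℂ with hT
  have hTT : T * T = 1 := by
    rw [hT, ← Matrix.permMatrix_mul, Equiv.swap_mul_self, Matrix.permMatrix_one]
  have hTs : star T = T := by
    rw [hT, Matrix.star_eq_conjTranspose, Matrix.conjTranspose_permMatrix, Equiv.swap_inv]
  let e : ℝ → ℂ := fun t => Complex.exp (t * Real.pi * Complex.I)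
  have he (t : ℝ) : e t * star (e t) = 1 := by
    rw [Complex.star_def, Complex.mul_conj, Complex.normSq_eq_norm_sq]
    have : ‖e t‖ = 1 := by
      simpa [e] using Complex.norm_exp_ofReal_mul_I (t * Real.pi)
    simp [this]
  have hstar (a b : ℂ) : star (a • (1 : CMat N) + b • T) = star a • (1 : CMat N) + star b • T := by
    rw [star_add, star_smul, star_smul, star_one, hTs]
  have hmul (a b c d : ℂ) : (a • (1 : CMat N) + b • T) * (c • (1 : CMat N) + d • T) =
      (a * c + b * d) • (1 : CMat N) + (a * d + b * c) • T := by
    simp only [mul_add, add_mul, smul_mul_smul_comm, hTT, one_mul, mul_one, add_smul]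
    abel
  -- T is a self-adjoint involution; the path is 1 on its (+1)-eigenspace and rotates from 1 to -1
  -- through exp(iπt) on its (-1)-eigenspace.
  refine ⟨⟨fun t => ((1 + e t) / 2) • (1 : CMat N) + ((1 - e t) / 2) • T, by fun_prop⟩,
    fun t => ?_, ?_, ?_⟩
  · have h1 : (1 + e t) / 2 * star ((1 + e t) / 2) + (1 - e t) / 2 * star ((1 - e t) / 2) = 1 := by
      simp only [star_div₀, star_add, star_sub, star_one, star_ofNat]
      linear_combination (1 / 2) * he t
    have h2 : (1 + e t) / 2 * star ((1 - e t) / 2) + (1 - e t) / 2 * star ((1 + e t) / 2) = 0 := by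
      simp only [star_div₀, star_add, star_sub, star_one, star_ofNat]
      linear_combination (-1 / 2) * he t
    rw [Unitary.mem_iff]
    simp only [ContinuousMap.coe_mk, hstar, hmul]
    rw [h1, h2, mul_comm (star ((1 + e t) / 2)), mul_comm (star ((1 - e t) / 2)), h1,
      mul_comm (star ((1 + e t) / 2)), mul_comm (star ((1 - e t) / 2)), add_comm (_ * _) (_ * _), h2]
    simp
  · simp [e]
  · simp [e]

theorem exists_unitary_path_permMatrix {N : ℕ} (σ : Equiv.Perm (Fin N)) :
    ∃ γ : C(ℝ, CMat N), (∀ t, γ t ∈ unitary (CMat N)) ∧ γ 0 = 1 ∧ γ 1 = σ.permMatrix ℂ := by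
  induction σ using Equiv.Perm.swap_induction_on with
  | one => exact ⟨ContinuousMap.const _ 1, fun t => one_mem _, rfl, by simp⟩
  | swap_mul σ i j _ ih =>
    obtain ⟨γ, hγ, h₀, h₁⟩ := ih
    obtain ⟨δ, hδ, k₀, k₁⟩ := exists_unitary_path_swap i j
    -- The factors are reversed because `permMatrix` is antimultiplicative.
    exact ⟨γ * δ, fun t => mul_mem (hγ t) (hδ t), by simp [h₀, k₀],
      by simp [h₁, k₁, Matrix.permMatrix_mul]⟩

theorem exists_unitary_interpolating {Y : Type*} [TopologicalSpace Y] [NormalSpace Y] [T1Space Y]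
    {y₀ y₁ : Y} (hy : y₀ ≠ y₁) {N : ℕ} (σ τ : Equiv.Perm (Fin N)) :
    ∃ u ∈ unitary C(Y, CMat N), u y₀ = σ.permMatrix ℂ ∧ u y₁ = τ.permMatrix ℂ := by
  obtain ⟨γ, hγ, h₀, h₁⟩ := exists_unitary_path_permMatrix σ
  obtain ⟨δ, hδ, k₀, k₁⟩ := exists_unitary_path_permMatrix τ
  obtain ⟨φ, hφ₀, hφ₁, -⟩ := exists_continuous_zero_one_of_isClosed
    (isClosed_singleton (x := y₀)) (isClosed_singleton (x := y₁)) (by simpa using hy)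
  have e₀ : φ y₀ = 0 := hφ₀ rfl
  have e₁ : φ y₁ = 1 := hφ₁ rfl
  -- Running γ backwards makes one factor trivial at each end: γ 1 * δ 0 at y₀ and γ 0 * δ 1 at y₁.
  let v : C(Y, CMat N) := ⟨fun y => γ (1 - φ y) * δ (φ y), by fun_prop⟩
  have hv (y) : v y ∈ unitary (CMat N) := mul_mem (hγ _) (hδ _)
  refine ⟨v, Unitary.mem_iff.2 ⟨?_, ?_⟩, ?_, ?_⟩
  · ext1 y
    exact Unitary.star_mul_self_of_mem (hv y)
  · ext1 y
    exact Unitary.mul_star_self_of_mem (hv y)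
  · simp [v, e₀, h₁, k₀]
  · simp [v, e₁, h₀, k₁]

theorem permMatrix_mul_mul_star {N : ℕ} (σ : Equiv.Perm (Fin N)) (A : CMat N) :
    σ.permMatrix ℂ * A * star (σ.permMatrix ℂ) = A.submatrix σ σ := by
  rw [Matrix.star_eq_conjTranspose, Matrix.conjTranspose_permMatrix]
  simp only [Equiv.Perm.permMatrix, PEquiv.toMatrix_toPEquiv_mul, PEquiv.mul_toMatrix_toPEquiv]
  rfl

/-! ### Bijections respecting labels -/

theorem exists_equiv_comp_eq {ι κ L : Type*} [Fintype ι] [Fintype κ] [DecidableEq L]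
    (f : ι → L) (g : κ → L)
    (h : ∀ x, ∑ i, (if f i = x then 1 else 0) = ∑ j, if g j = x then 1 else 0) :
    ∃ e : ι ≃ κ, ∀ i, g (e i) = f i := by
  have hc (x : L) : Nonempty ({i // f i = x} ≃ {j // g j = x}) := by
    rw [← Fintype.card_eq, Fintype.card_subtype, Fintype.card_subtype, Finset.card_filter,
      Finset.card_filter]
    exact h x
  exact ⟨Equiv.ofFiberEquiv fun x => (hc x).some, fun i => Equiv.ofFiberEquiv_map _ i⟩

theorem sum_none_add_sum_some {ι L : Type*} [Fintype ι] [Fintype L] [DecidableEq L]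
    (f : ι → Option L) :
    ∑ i, (if f i = none then 1 else 0) + ∑ x, ∑ i, (if f i = some x then 1 else 0) =
      Fintype.card ι := by
  rw [← Fintype.sum_option (fun x => ∑ i, if f i = x then 1 else 0), Finset.sum_comm]
  simp

/-- Equal total sizes force the `none` labels to agree, so the zero rows never have to be counted.
-/
theorem exists_equiv_comp_eq_of_option {ι κ L : Type*} [Fintype ι] [Fintype κ] [Fintype L]
    [DecidableEq L] (f : ι → Option L) (g : κ → Option L) (hcard : Fintype.card ι = Fintype.card κ)
    (h : ∀ x : L, ∑ i, (if f i = some x then 1 else 0) = ∑ j, if g j = some x then 1 else 0) :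
    ∃ e : ι ≃ κ, ∀ i, g (e i) = f i := by
  refine exists_equiv_comp_eq f g ?_
  rintro (_ | x)
  · have h₁ := sum_none_add_sum_some f
    have h₂ := sum_none_add_sum_some g
    simp only [h] at h₁
    omega
  · exact h x

/-! ### Direct sums of evaluations, scalars and zeros, described by labels

An index labelled `none` contributes a zero row and column, one labelled `some none` a diagonal
entry `c`, and the indices labelled `some (some (j, a))` carry the block `A j`. -/

def labelMatrix {ι J : Type*} {n : ℕ} [DecidableEq ι] [DecidableEq J]
    (lab : ι → Option (Option (J × Fin n))) (A : J → CMat n) (c : ℂ) : Matrix ι ι ℂ :=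
  Matrix.of fun i i' => match lab i, lab i' with
    | some none, _ => if i = i' then c else 0
    | some (some (j, a)), some (some (j', a')) => if j = j' then A j a a' else 0
    | _, _ => 0

/-- Entries depend only on labels and equality of indices, so one label-preserving bijection serves
all A and c at once. This makes the permutation independent of f. -/
theorem labelMatrix_submatrix {ι κ J : Type*} {n : ℕ} [DecidableEq ι] [DecidableEq κ]
    [DecidableEq J] {f : ι → Option (Option (J × Fin n))} {g : κ → Option (Option (J × Fin n))}
    (e : ι ≃ κ) (h : ∀ i, g (e i) = f i) (A : J → CMat n) (c : ℂ) :
    (labelMatrix g A c).submatrix e e = labelMatrix f A c := by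
  ext i i'
  simp only [labelMatrix, Matrix.submatrix_apply, Matrix.of_apply, h, e.injective.eq_iff]

section Labels

variable {k d s : ℕ}

/-- The labels of the index set of `diag (f x₀, …, f x₀, f x₁, …, f x₁, f z₁, …, f z₁, …)`. -/
def blockLabel {a₀ a₁ : ℕ} :
    (Fin a₀ ⊕ Fin a₁) ⊕ (Fin d × Fin s) → Fin (k + 1) →
      Option (Option ((Fin d × Fin s) × Fin (k + 1)))
  | .inl (.inl _), a => if a = Fin.last k then none else some none
  | .inl (.inr _), _ => some none
  | .inr j, a => some (some (j, a))

/-- The labels of the index set of `diag (f x₀, …, f x₁, …, f z₁, …, 0, …, 0)`, with the blocks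
permuted. -/
def sourceLabel {a₀ a₁ p r : ℕ} (e : Fin p ≃ (Fin a₀ ⊕ Fin a₁) ⊕ (Fin d × Fin s)) :
    (Fin (k + 1) × Fin p) ⊕ Fin r → Option (Option ((Fin d × Fin s) × Fin (k + 1)))
  | .inl (a, i) => blockLabel (e i) a
  | .inr _ => none

theorem sum_sourceLabel {a₀ a₁ p : ℕ} (r : ℕ)
    (e : Fin p ≃ (Fin a₀ ⊕ Fin a₁) ⊕ (Fin d × Fin s))
    (x : Option ((Fin d × Fin s) × Fin (k + 1))) :
    ∑ i, (if sourceLabel (r := r) e i = some x then 1 else 0) =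
      if x = none then k * a₀ + (k + 1) * a₁ else 1 := by
  rw [Fintype.sum_sum_type, Fintype.sum_prod_type_right]
  change ∑ i, ∑ a, (if blockLabel (e i) a = some x then 1 else 0) +
    ∑ _ : Fin r, (if none = some x then 1 else 0) = _
  rw [e.sum_comp (fun v => ∑ a, if blockLabel v a = some x then 1 else 0),
    Fintype.sum_sum_type, Fintype.sum_sum_type]
  rcases x with _ | ⟨c, a⟩
  · simp only [blockLabel, Fin.sum_univ_castSucc]
    simp [Fin.castSucc_ne_last]
    ring
  · have h₀ : ∀ (b : Fin (k + 1)), (if b = Fin.last k then none else some none) ≠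
        some (some (c, a)) := fun b => by split_ifs <;> simp
    simp [blockLabel, h₀, ite_and]

theorem labelMatrix_sourceLabel {X : Type*} {x₀ x₁ : X} {a₀ a₁ p : ℕ} (r : ℕ) {z : Fin s → X}
    (e : Fin p ≃ (Fin a₀ ⊕ Fin a₁) ⊕ (Fin d × Fin s)) {β : Fin p → X}
    (hβ : ∀ i, Sum.elim (Sum.elim (fun _ => x₀) fun _ => x₁) (fun j => z j.2) (e i) = β i)
    {f : X → CMat (k + 1)} {c : ℂ}
    (h₀ : f x₀ = Matrix.diagonal fun i => if i = Fin.last k then 0 else c)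
    (h₁ : f x₁ = Matrix.diagonal fun _ => c) :
    labelMatrix (sourceLabel e) (fun j => f (z j.2)) c =
      Matrix.fromBlocks (Matrix.blockDiagonal fun i => f (β i)) 0 0 (0 : CMat r) := by
  ext u v
  rcases u with ⟨a, i⟩ | u <;> rcases v with ⟨b, j⟩ | v
  · simp only [labelMatrix, sourceLabel, Matrix.of_apply, Matrix.fromBlocks_apply₁₁,
      Matrix.blockDiagonal_apply, ← hβ, Sum.inl.injEq, Prod.mk.injEq]
    have hij : i = j ↔ e i = e j := e.apply_eq_iff_eq.symm
    simp only [hij]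
    rcases e i with (i | i) | i <;> rcases e j with (j | j) | j <;>
      simp only [blockLabel, Sum.elim_inl, Sum.elim_inr, h₀, h₁, Matrix.diagonal_apply] <;>
      split_ifs <;> simp_all
  · simp only [labelMatrix, sourceLabel, Matrix.of_apply, Matrix.fromBlocks_apply₁₂]
    rcases blockLabel (e i) a with _ | _ | _ <;> simp
  · simp [labelMatrix, sourceLabel]
  · simp [labelMatrix, sourceLabel]

/-- The labels of the index set of `diag (f z₁, …, f z_s, c, …, c, 0, …, 0)`. -/
def baseLabel {t q : ℕ} :
    (Fin s × Fin (k + 1)) ⊕ (Fin t ⊕ Fin q) → Option (Option (Fin s × Fin (k + 1)))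
  | .inl x => some (some x)
  | .inr (.inl _) => some none
  | .inr (.inr _) => none

/-- The labels of the index set of `diag (B, …, B, 0, …, 0)` with `d` copies of a matrix `B`
described by the labels `lab`. -/
def targetLabel {m : ℕ} (n d : ℕ) (lab : Fin m → Option (Option (Fin s × Fin (k + 1)))) :
    Fin n × Fin m → Option (Option ((Fin d × Fin s) × Fin (k + 1))) := fun x =>
  if h : (x.1 : ℕ) < d then
    (lab x.2).map (Option.map fun ja => ((⟨x.1, h⟩, ja.1), ja.2))
  else none

theorem labelMatrix_targetLabel {m : ℕ} (n : ℕ)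
    (lab : Fin m → Option (Option (Fin s × Fin (k + 1)))) (A : Fin s → CMat (k + 1)) (c : ℂ) :
    labelMatrix (targetLabel n d lab) (fun j => A j.2) c =
      (Matrix.diagonal fun i : Fin n => if (i : ℕ) < d then 1 else 0) ⊗ₖ labelMatrix lab A c := by
  ext ⟨a, i⟩ ⟨b, j⟩
  simp only [labelMatrix, targetLabel, Matrix.of_apply, Matrix.kroneckerMap_apply,
    Matrix.diagonal_apply, Prod.mk.injEq]
  by_cases ha : (a : ℕ) < d <;> by_cases hb : (b : ℕ) < d <;> by_cases hab : a = b <;>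
    rcases lab i with _ | _ | ⟨i', a'⟩ <;> rcases lab j with _ | _ | ⟨j', b'⟩ <;>
    simp_all [Fin.ext_iff]

theorem sum_targetLabel {m n t q : ℕ} (hd : d ≤ n)
    (w : Fin m ≃ (Fin s × Fin (k + 1)) ⊕ (Fin t ⊕ Fin q))
    (x : Option ((Fin d × Fin s) × Fin (k + 1))) :
    ∑ i, (if targetLabel n d (fun i => baseLabel (w i)) i = some x then 1 else 0) =
      if x = none then d * t else 1 := by
  obtain ⟨n, rfl⟩ := Nat.exists_eq_add_of_le hd
  have h₁ (c : Fin d) (i : Fin m) :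
      targetLabel (d + n) d (fun i => baseLabel (w i)) (Fin.castAdd n c, i) =
        (baseLabel (w i)).map (Option.map fun ja => ((c, ja.1), ja.2)) := by
    simp [targetLabel]
  have h₂ (c : Fin n) (i : Fin m) :
      targetLabel (d + n) d (fun i => baseLabel (w i)) (Fin.natAdd d c, i) = none := by
    simp [targetLabel]
  rw [Fintype.sum_prod_type, Fin.sum_univ_add]
  simp only [h₁, h₂]
  have h₃ (c : Fin d) := w.sum_comp (fun v =>
    if (baseLabel v).map (Option.map fun ja => ((c, ja.1), ja.2)) = some x then 1 else 0)
  simp only [h₃, Fintype.sum_sum_type]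
  rcases x with _ | ⟨⟨c, j⟩, a⟩
  · simp [baseLabel]
  · simp [baseLabel, Fintype.sum_prod_type, ite_and]

end Labels

/-! ### From multiplicities to a unitary -/

theorem exists_equiv_of_map_univ_eq {X : Type*} {x₀ x₁ : X} {p a₀ a₁ d s : ℕ} {z : Fin s → X}
    {β : Fin p → X}
    (hβ : Finset.univ.val.map β = Multiset.replicate a₀ x₀ + Multiset.replicate a₁ x₁ +
      ∑ j, Multiset.replicate d (z j)) :
    ∃ e : Fin p ≃ (Fin a₀ ⊕ Fin a₁) ⊕ (Fin d × Fin s),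
      ∀ i, Sum.elim (Sum.elim (fun _ => x₀) fun _ => x₁) (fun j => z j.2) (e i) = β i := by
  classical
  refine exists_equiv_comp_eq _ _ fun x => ?_
  have h := congrArg (Multiset.count x) hβ
  rw [Multiset.count_map, Multiset.count_add, Multiset.count_add, Multiset.count_sum'] at h
  simp only [Multiset.count_replicate] at h
  rw [Finset.sum_boole, Fintype.sum_sum_type, Fintype.sum_sum_type, Fintype.sum_prod_type]
  simp only [eq_comm (a := x)] at h
  rw [Nat.cast_id]
  refine h.trans ?_
  change _ = ∑ _ : Fin a₀, (if x₀ = x then 1 else 0) + ∑ _ : Fin a₁, (if x₁ = x then 1 else 0) +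
    ∑ _ : Fin d, ∑ j, (if z j = x then 1 else 0)
  simp only [Finset.sum_const, Finset.card_univ, Fintype.card_fin, smul_eq_mul, Finset.mul_sum,
    mul_ite, mul_one, mul_zero]

/-- Both sides carry the same labels: each block entry once and the scalar d·t times. It serves y₀
with d = l and y₁ with d = l + 1, both with n = l + 1. -/
theorem exists_perm_kronFin_eq_submatrix {X Y : Type*} [TopologicalSpace X] [TopologicalSpace Y]
    {x₀ x₁ : X} {k n m p r d s t q a₀ a₁ : ℕ} (h : p * (k + 1) + r = n * m) (hd : d ≤ n)
    {α : Fin p → C(Y, X)} {y : Y} {z : Fin s → X}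
    (hα : (Finset.univ.val.map fun i => α i y) = Multiset.replicate a₀ x₀ +
      Multiset.replicate a₁ x₁ + ∑ j, Multiset.replicate d (z j))
    (ht : k * a₀ + (k + 1) * a₁ = d * t)
    (w : Fin m ≃ (Fin s × Fin (k + 1)) ⊕ (Fin t ⊕ Fin q)) :
    ∃ σ : Equiv.Perm (Fin (n * m)), ∀ (f : C(X, CMat (k + 1))) (c : ℂ),
      f x₀ = Matrix.diagonal (fun i => if i = Fin.last k then 0 else c) →
      f x₁ = Matrix.diagonal (fun _ => c) →
      (diagMap h α f y).submatrix σ σ =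
        kronFin (Matrix.diagonal fun i => if (i : ℕ) < d then 1 else 0)
          (labelMatrix (fun i => baseLabel (w i)) (fun j => f (z j)) c) := by
  obtain ⟨e, he⟩ := exists_equiv_of_map_univ_eq hα
  obtain ⟨τ, hτ⟩ := exists_equiv_comp_eq_of_option
    (targetLabel n d fun i => baseLabel (w i)) (sourceLabel (r := r) e)
    (by simp only [Fintype.card_sum, Fintype.card_prod, Fintype.card_fin]; rw [← h, mul_comm p])
    (fun x => by rw [sum_sourceLabel, sum_targetLabel hd, ht])
  let ε : (Fin (k + 1) × Fin p) ⊕ Fin r ≃ Fin (n * m) :=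
    (Equiv.sumCongr ((Equiv.prodComm (Fin (k + 1)) (Fin p)).trans finProdFinEquiv)
      (Equiv.refl (Fin r))).trans (finSumFinEquiv.trans (finCongr h))
  refine ⟨finProdFinEquiv.symm.trans (τ.trans ε), fun f c h₀ h₁ => ?_⟩
  have hD : diagMap h α f y = Matrix.reindex ε ε (labelMatrix (sourceLabel e)
      (fun j => f (z j.2)) c) := by
    rw [labelMatrix_sourceLabel r e he h₀ h₁]
    rfl
  rw [hD, kronFin, ← labelMatrix_targetLabel n _ (fun j => f (z j)) c,
    ← labelMatrix_submatrix τ hτ]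
  ext i j
  simp

theorem exists_unitary_of_multiplicities {X Y : Type*} [TopologicalSpace X]
    [TopologicalSpace Y] [NormalSpace Y] [T1Space Y]
    {x₀ x₁ : X} {y₀ y₁ : Y} (hy : y₀ ≠ y₁)
    {k l m p r : ℕ} (h : p * (k + 1) + r = (l + 1) * m) {α : Fin p → C(Y, X)}
    {s : ℕ} {z : Fin s → X} {a₀ a₁ b₀ b₁ t q : ℕ} (hm : m = s * (k + 1) + (t + q))
    (hα₀ : (Finset.univ.val.map fun i => α i y₀) = Multiset.replicate a₀ x₀ +
      Multiset.replicate a₁ x₁ + ∑ j, Multiset.replicate l (z j))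
    (hα₁ : (Finset.univ.val.map fun i => α i y₁) = Multiset.replicate b₀ x₀ +
      Multiset.replicate b₁ x₁ + ∑ j, Multiset.replicate (l + 1) (z j))
    (ht₀ : k * a₀ + (k + 1) * a₁ = l * t) (ht₁ : k * b₀ + (k + 1) * b₁ = (l + 1) * t) :
    ∃ u ∈ unitary C(Y, CMat ((l + 1) * m)), ∀ f ∈ razakBlock x₀ x₁ k,
      u * diagMap h α f * star u ∈ tensorMat (razakBlock y₀ y₁ l) m := by
  let w : Fin m ≃ (Fin s × Fin (k + 1)) ⊕ (Fin t ⊕ Fin q) :=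
    Fintype.equivOfCardEq (by simp [hm])
  obtain ⟨σ₀, hσ₀⟩ := exists_perm_kronFin_eq_submatrix h (Nat.le_succ l) hα₀ ht₀ w
  obtain ⟨σ₁, hσ₁⟩ := exists_perm_kronFin_eq_submatrix h le_rfl hα₁ ht₁ w
  obtain ⟨u, hu, hu₀, hu₁⟩ := exists_unitary_interpolating hy σ₀ σ₁
  -- The same B must occur at both endpoints; hence the one bijection `w` shared by both
  -- permutations.
  refine ⟨u, hu, fun f ⟨c, hc₀, hc₁⟩ => mem_tensorMat_of_eq_kronFin
    (B := labelMatrix (fun i => baseLabel (w i)) (fun j => f (z j)) c) ?_ ?_⟩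
  · rw [ContinuousMap.mul_apply, ContinuousMap.mul_apply, ContinuousMap.star_apply, hu₀,
      permMatrix_mul_mul_star, hσ₀ f c hc₀ hc₁]
    congr 2
    ext i
    rcases Fin.eq_castSucc_or_eq_last i with ⟨j, rfl⟩ | rfl
    · simp [Fin.castSucc_ne_last]
    · simp
  · rw [ContinuousMap.mul_apply, ContinuousMap.mul_apply, ContinuousMap.star_apply, hu₁,
      permMatrix_mul_mul_star, hσ₁ f c hc₀ hc₁, ← Matrix.diagonal_one]
    congr 2
    ext i
    simp [Nat.le_of_lt_succ i.isLt]

theorem mainTheorem3 {X Y : Type*}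
    [TopologicalSpace X] [CompactSpace X] [T2Space X]
    [TopologicalSpace Y] [CompactSpace Y] [T2Space Y]
    (x₀ x₁ : X) (hx : x₀ ≠ x₁) (y₀ y₁ : Y) (hy : y₀ ≠ y₁)
    (k l m p r : ℕ) (h : p * (k + 1) + r = m * (l + 1))
    (α : Fin p → C(Y, X)) :
    (∃ u ∈ unitary C(Y, CMat ((l + 1) * m)), ∀ f ∈ razakBlock x₀ x₁ k,
      u * diagMap (h.trans (Nat.mul_comm m (l + 1))) α f * star u ∈
        tensorMat (razakBlock y₀ y₁ l) m) ↔
    ∃ (s : ℕ) (z : Fin s → X) (a₀ a₁ b₀ b₁ q : ℕ),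
      (Finset.univ.val.map fun i => α i y₀) =
        Multiset.replicate a₀ x₀ + Multiset.replicate a₁ x₁ +
          ∑ j, Multiset.replicate l (z j) ∧
      (Finset.univ.val.map fun i => α i y₁) =
        Multiset.replicate b₀ x₀ + Multiset.replicate b₁ x₁ +
          ∑ j, Multiset.replicate (l + 1) (z j) ∧
      (k * a₀ + (k + 1) * a₁ : ℤ) = (m - s * (k + 1) - q) * l ∧
      (k * b₀ + (k + 1) * b₁ : ℤ) = (m - s * (k + 1) - q) * (l + 1) := by
  constructor
  · rintro ⟨u, hu, H⟩
    exact exists_multiplicities_of_unitary hx _ hu H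
  · rintro ⟨s, z, a₀, a₁, b₀, b₁, q, hα₀, hα₁, h₀, h₁⟩
    -- The y₁ equation decides the sign, its factor l + 1 being positive even when l = 0.
    have hpos : (0 : ℤ) ≤ m - s * (k + 1) - q := by
      by_contra! hneg
      have : (0 : ℤ) ≤ k * b₀ + (k + 1) * b₁ := by positivity
      nlinarith
    obtain ⟨t, ht⟩ := Int.eq_ofNat_of_zero_le hpos
    rw [ht, mul_comm (t : ℤ)] at h₀ h₁
    exact exists_unitary_of_multiplicities hy _ (t := t) (q := q) (by zify; linarith) hα₀ hα₁
      (by exact_mod_cast h₀) (by exact_mod_cast h₁)
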